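/- Let $1\le p<\infty$, $0<H<1$, and let $X=(X(t))_{t\in\mathbb R}$ be a fractional Brownian motion with Hurst parameter $H$ on a probability space, i.e. a centred real Gaussian process with $\mathbb E[X(s)X(t)]=\tfrac12\left(|s|^{2H}+|t|^{2H}-|t-s|^{2H}\right)$ for all $s,t\in\mathbb R$. Let $w:\mathbb R\to\mathbb C$ be a continuous window function, supported in $[0,1]$ and of bounded variation on $[0,1]$. For a scale $s>0$ and a frequency $\xi\in\mathbb R$ put $\gamma=(s,\xi)$, $g_\gamma(t)=w(t/s)e^{i\xi t}$ and $(g_\gamma* dX)(t)=\int_{\mathbb R}g_\gamma(t-u)\,dX(u)$. Here the integral of a compactly supported deterministic function against $dX$ is taken over a compact interval containing its support, and $\int_a^b f(u)\,dX(u)$ denotes the limit in probability of the Riemann sums $\sum_i f(\tau_i)\,(X(x_{i+1})-X(x_i))$ over the tagged partitions of $[a,b]$ as the mesh tends to $0$. Let $S_{\gamma,p}X(t)=\mathbb E\left[|(g_\gamma* dX)(t)|^p\right]$ and $$SX(\gamma,p)=\lim_{R\to\infty}\frac1{2R}\int_{|t|\le R}S_{\gamma,p}X(t)\,dt .$$ Let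 $\gamma_k=(s_k,\xi_k)$ be a sequence with $s_k>0$, $\lim_{k\to\infty}s_k=0$ and $\lim_{k\to\infty}s_k\xi_k=L\in\mathbb R$. Then all the integrals against $dX$ below and in the definition of $S_{\gamma_k,p}X(t)$ exist and have finite $p$-th absolute moments, the limits $SX(\gamma_k,p)$ exist, $S_{\gamma_k,p}X(t)=SX(\gamma_k,p)$ for all $t\in\mathbb R$, and $$\lim_{k\to\infty}\frac{SX(\gamma_k,p)}{s_k^{pH}}=\mathbb E\left[\left|\int_0^1 w(u)e^{iLu}\,dX(u)\right|^p\right].$$ -/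

import Mathlib

open MeasureTheory ProbabilityTheory Filter Topology Set

noncomputable section

/-- A (standard) fractional Brownian motion on the real line with Hurst parameter `H`: a centred
Gaussian process with covariance `(|s|^{2H} + |t|^{2H} - |t - s|^{2H}) / 2`. Path continuity is not
imposed; a process with continuous paths is a special case. -/
structure IsFractionalBrownianMotion {Ω : Type*} [MeasurableSpace Ω] (P : Measure Ω) (H : ℝ)
    (X : ℝ → Ω → ℝ) : Prop where
  isGaussianProcess : IsGaussianProcess X P
  integral_eq_zero : ∀ t, ∫ ω, X t ω ∂P = 0
  covariance_eq : ∀ s t,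
    covariance (X s) (X t) P = (|s| ^ (2 * H) + |t| ^ (2 * H) - |t - s| ^ (2 * H)) / 2

/-- Tagged partitions `a = x₀ ≤ τ₀ ≤ x₁ ≤ τ₁ ≤ ⋯ ≤ xₙ = b` of the interval `[a, b]`. -/
structure TaggedPartition (a b : ℝ) where
  n : ℕ
  node : Fin (n + 1) → ℝ
  tag : Fin n → ℝ
  node_zero : node 0 = a
  node_last : node (Fin.last n) = b
  node_le_tag : ∀ i, node i.castSucc ≤ tag i
  tag_le_node : ∀ i, tag i ≤ node i.succ

namespace TaggedPartition

variable {a b : ℝ}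

/-- The mesh, i.e. the largest length of a cell. -/
def mesh (π : TaggedPartition a b) : ℝ :=
  ⨆ i : Fin π.n, (π.node i.succ - π.node i.castSucc)

/-- The filter "the mesh tends to zero" on the tagged partitions of `[a, b]`. -/
def fine (a b : ℝ) : Filter (TaggedPartition a b) :=
  Filter.comap mesh (𝓝 0)

/-- The Riemann(-Stieltjes) sum `∑ f(τᵢ) (x(xᵢ₊₁) - x(xᵢ))`. -/
def riemannSum (π : TaggedPartition a b) (f : ℝ → ℂ) (x : ℝ → ℝ) : ℂ :=
  ∑ i : Fin π.n, f (π.tag i) * ((x (π.node i.succ) - x (π.node i.castSucc) : ℝ) : ℂ)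

end TaggedPartition

section StochasticIntegral

variable {Ω : Type*} [MeasurableSpace Ω]

/-- `Z` is the integral `∫_a^b f(u) dX(u)` of the deterministic function `f`: the limit in
probability of the Riemann sums over the tagged partitions of `[a, b]`, as the mesh tends to zero.
Such a `Z` is unique almost surely (for `a ≤ b`). -/
def IsStochIntegral (P : Measure Ω) (X : ℝ → Ω → ℝ) (f : ℝ → ℂ) (a b : ℝ) (Z : Ω → ℂ) : Prop :=
  AEMeasurable Z P ∧
    TendstoInMeasure P (fun (π : TaggedPartition a b) ω => π.riemannSum f (fun u => X u ω))
      (TaggedPartition.fine a b) Z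

/-- `Z` is the integral `∫_ℝ f(u) dX(u)` of the compactly supported deterministic function `f`:
it is the integral over `[a, b]`, for every compact interval `[a, b]` that contains the
support of `f`. -/
def IsStochIntegralLine (P : Measure Ω) (X : ℝ → Ω → ℝ) (f : ℝ → ℂ) (Z : Ω → ℂ) : Prop :=
  HasCompactSupport f ∧
    ∀ a b : ℝ, a ≤ b → Function.support f ⊆ Icc a b → IsStochIntegral P X f a b Z

open Classical in
/-- The random variable `∫_a^b f(u) dX(u)` (zero if the integral does not exist). -/
def stochIntegral (P : Measure Ω) (X : ℝ → Ω → ℝ) (f : ℝ → ℂ) (a b : ℝ) : Ω → ℂ :=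
  if h : ∃ Z, IsStochIntegral P X f a b Z then h.choose else 0

open Classical in
/-- The random variable `∫_ℝ f(u) dX(u)` (zero if the integral does not exist). -/
def stochIntegralLine (P : Measure Ω) (X : ℝ → Ω → ℝ) (f : ℝ → ℂ) : Ω → ℂ :=
  if h : ∃ Z, IsStochIntegralLine P X f Z then h.choose else 0

/-- The Gabor-type filter `g_γ(t) = w(t / s) e^{i ξ t}` with scale `s` and frequency `ξ`,
where `γ = (s, ξ)`. -/
def gaborFilter (w : ℝ → ℂ) (γ : ℝ × ℝ) (t : ℝ) : ℂ :=
  w (t / γ.1) * Complex.exp (Complex.I * γ.2 * t)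

/-- The random variable `(g_γ ∗ dX)(t) = ∫_ℝ g_γ(t - u) dX(u)`. -/
def filterNoise (P : Measure Ω) (X : ℝ → Ω → ℝ) (w : ℝ → ℂ) (γ : ℝ × ℝ) (t : ℝ) : Ω → ℂ :=
  stochIntegralLine P X (fun u => gaborFilter w γ (t - u))

/-- The first-order scattering moment `S_{γ,p} X(t) = E |(g_γ ∗ dX)(t)|^p` at location `t`. -/
def scatteringMoment (P : Measure Ω) (X : ℝ → Ω → ℝ) (w : ℝ → ℂ) (γ : ℝ × ℝ) (p t : ℝ) : ℝ :=
  ∫ ω, ‖filterNoise P X w γ t ω‖ ^ p ∂P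

/-- The average `(2R)⁻¹ ∫_{|t| ≤ R} S_{γ,p} X(t) dt`. -/
def averagedScatteringMoment (P : Measure Ω) (X : ℝ → Ω → ℝ) (w : ℝ → ℂ) (γ : ℝ × ℝ)
    (p R : ℝ) : ℝ :=
  (2 * R)⁻¹ * ∫ t in (-R)..R, scatteringMoment P X w γ p t

/-- The invariant first-order scattering moment
`SX(γ, p) = lim_{R → ∞} (2R)⁻¹ ∫_{|t| ≤ R} S_{γ,p} X(t) dt`. -/
def invariantScatteringMoment (P : Measure Ω) (X : ℝ → Ω → ℝ) (w : ℝ → ℂ) (γ : ℝ × ℝ)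
    (p : ℝ) : ℝ :=
  limUnder atTop (averagedScatteringMoment P X w γ p)

end StochasticIntegral

end

/-! The process is viewed as a curve $Y$ in the complex Banach space $L^p(P)$. Its increments are
Gaussian with standard deviation $|t-r|^H$, so $\|Y(t)-Y(r)\|_p = C|t-r|^H$ and $Y$ is uniformly
continuous. The stochastic integrals are then norm limits of Riemann–Stieltjes sums, and norm
convergence in $L^p$ implies convergence in probability.

Everything analytic rests on summation by parts: a sum is bounded by $(2\sup|f| + \mathrm{Var}
f)\sup\|Y\|$ (`norm_vectorSum_le`). Replacing $Y$ by a sliding mean of width $\varepsilon$ costs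
little, uniformly in the partition, and the smoothed sums converge to $\int
f\,\varepsilon^{-1}(Y(\cdot+\varepsilon)-Y)$. Hence the limit exists and is also the limit of these
integrals (`exists_tendsto_vectorSum`). The second description mentions no partition, so
independence of the interval and the change of variables $u=t-sv$ reduce to facts about Bochner
integrals.

That substitution turns $(g_\gamma*dX)(t)$ into an integral of $w(v)e^{is\xi v}$ against $v\mapsto
X(t)-X(t-sv)$. By self-similarity and stationarity of increments, its norm is $s^H\|I(s\xi)\|_p$,
where $I(l)=\int_0^1 w(v)e^{ilv}\,dX(v)$. So $SX(\gamma,p)=s^{pH}\|I(s\xi)\|_p^p$ exactly at every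
scale. The limit is then the continuity of $I$ in $l$, again by `norm_vectorSum_le`, since
$w(e^{il\cdot}-e^{iL\cdot})$ has supremum and variation $O(|l-L|)$. -/

noncomputable section

/-! ### Abel summation -/

section SummationByParts

variable {E : Type*} [NormedAddCommGroup E] [NormedSpace ℂ E]

theorem sum_range_smul_sub_eq (c : ℕ → ℂ) (y : ℕ → E) (n : ℕ) :
    ∑ i ∈ Finset.range n, c i • (y (i + 1) - y i) =
      c n • y n - c 0 • y 0 - ∑ i ∈ Finset.range n, (c (i + 1) - c i) • y (i + 1) := by
  induction n with
  | zero => simp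
  | succ n ih =>
    rw [Finset.sum_range_succ, ih, Finset.sum_range_succ]
    module

end SummationByParts

/-! ### Tagged partitions and estimates for Riemann–Stieltjes sums -/

namespace TaggedPartition

variable {a b : ℝ}

/-- The nodes of a tagged partition, as a sequence that is eventually equal to `b`. -/
def natNode (π : TaggedPartition a b) (k : ℕ) : ℝ :=
  if h : k < π.n + 1 then π.node ⟨k, h⟩ else b

/-- The tags of a tagged partition, as a sequence that is eventually equal to `b`. -/
def natTag (π : TaggedPartition a b) (k : ℕ) : ℝ :=
  if h : k < π.n then π.tag ⟨k, h⟩ else b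

theorem natNode_zero (π : TaggedPartition a b) : π.natNode 0 = a := by
  have h : (0 : ℕ) < π.n + 1 := Nat.succ_pos _
  simp only [natNode, h, dif_pos]
  exact π.node_zero

theorem natNode_of_le (π : TaggedPartition a b) {k : ℕ} (hk : π.n ≤ k) : π.natNode k = b := by
  unfold natNode
  split_ifs with h
  · obtain rfl : k = π.n := by omega
    exact π.node_last
  · rfl

theorem natTag_of_le (π : TaggedPartition a b) {k : ℕ} (hk : π.n ≤ k) : π.natTag k = b := by
  simp [natTag, hk]

theorem natNode_castSucc (π : TaggedPartition a b) (i : Fin π.n) :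
    π.natNode i = π.node i.castSucc := by
  have h : (i : ℕ) < π.n + 1 := by omega
  simp only [natNode, h, dif_pos]
  rfl

theorem natNode_succ (π : TaggedPartition a b) (i : Fin π.n) :
    π.natNode (i + 1) = π.node i.succ := by
  have h : (i : ℕ) + 1 < π.n + 1 := by omega
  simp only [natNode, h, dif_pos]
  rfl

theorem natTag_coe (π : TaggedPartition a b) (i : Fin π.n) : π.natTag i = π.tag i := by
  simp [natTag]

theorem natNode_le_natTag (π : TaggedPartition a b) (k : ℕ) : π.natNode k ≤ π.natTag k := by
  rcases lt_or_ge k π.n with h | h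
  · have := π.node_le_tag ⟨k, h⟩
    rwa [← natNode_castSucc, ← natTag_coe] at this
  · rw [π.natNode_of_le h, π.natTag_of_le h]

theorem natTag_le_natNode (π : TaggedPartition a b) (k : ℕ) : π.natTag k ≤ π.natNode (k + 1) := by
  rcases lt_or_ge k π.n with h | h
  · have := π.tag_le_node ⟨k, h⟩
    rwa [← natNode_succ, ← natTag_coe] at this
  · rw [π.natNode_of_le (by omega), π.natTag_of_le h]

theorem monotone_natNode (π : TaggedPartition a b) : Monotone π.natNode :=
  monotone_nat_of_le_succ fun k => (π.natNode_le_natTag k).trans (π.natTag_le_natNode k)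

theorem monotone_natTag (π : TaggedPartition a b) : Monotone π.natTag :=
  monotone_nat_of_le_succ fun k => (π.natTag_le_natNode k).trans (π.natNode_le_natTag (k + 1))

theorem natNode_mem (π : TaggedPartition a b) (k : ℕ) : π.natNode k ∈ Icc a b := by
  constructor
  · exact π.natNode_zero.ge.trans (π.monotone_natNode (Nat.zero_le k))
  · exact (π.monotone_natNode (le_max_right _ _)).trans (π.natNode_of_le (le_max_left π.n k)).le

theorem natTag_mem (π : TaggedPartition a b) (k : ℕ) : π.natTag k ∈ Icc a b :=
  ⟨(π.natNode_mem k).1.trans (π.natNode_le_natTag k),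
    (π.natTag_le_natNode k).trans (π.natNode_mem (k + 1)).2⟩

theorem natNode_sub_le_mesh (π : TaggedPartition a b) {k : ℕ} (hk : k < π.n) :
    π.natNode (k + 1) - π.natNode k ≤ π.mesh := by
  have := le_ciSup (f := fun i : Fin π.n => π.node i.succ - π.node i.castSucc)
    (Set.finite_range _).bddAbove ⟨k, hk⟩
  rwa [← natNode_succ, ← natNode_castSucc] at this

/-- The partition of `[a, b]` into `N + 1` intervals of equal length. -/
def uniform (hab : a ≤ b) (N : ℕ) : TaggedPartition a b where
  n := N + 1
  node i := a + i * ((b - a) / (N + 1))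
  tag i := a + i * ((b - a) / (N + 1))
  node_zero := by simp
  node_last := by
    have : (N : ℝ) + 1 ≠ 0 := by positivity
    simp only [Fin.val_last]
    push_cast
    field_simp
    ring
  node_le_tag i := by simp
  tag_le_node i := by
    have : 0 ≤ (b - a) / ((N : ℝ) + 1) := div_nonneg (by linarith) (by positivity)
    simp only [Fin.val_succ]
    push_cast
    nlinarith

theorem mesh_uniform (hab : a ≤ b) (N : ℕ) : (uniform hab N).mesh = (b - a) / (N + 1) := by
  have : ∀ i : Fin (N + 1), (uniform hab N).node i.succ - (uniform hab N).node i.castSucc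
      = (b - a) / (N + 1) := by
    intro i
    simp only [uniform, Fin.val_succ, Fin.val_castSucc]
    push_cast
    ring
  exact (congrArg iSup (funext this)).trans ciSup_const

theorem fine_neBot (hab : a ≤ b) : (fine a b).NeBot := by
  have h : Tendsto (fun N : ℕ => (uniform hab N).mesh) atTop (𝓝 0) := by
    simp only [mesh_uniform]
    exact tendsto_const_nhds.div_atTop
      (tendsto_atTop_add_const_right _ _ tendsto_natCast_atTop_atTop)
  exact (tendsto_comap_iff.2 h : Tendsto (uniform hab) atTop (fine a b)).neBot

instance : (fine a b).IsCountablyGenerated := by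
  unfold fine; infer_instance

theorem eventually_mesh_lt {δ : ℝ} (hδ : 0 < δ) : ∀ᶠ π in fine a b, mesh π < δ :=
  tendsto_comap.eventually (eventually_lt_nhds hδ)

variable {E : Type*} [NormedAddCommGroup E] [NormedSpace ℂ E]

/-- The Riemann-Stieltjes sum `∑ f(τᵢ) (Y(xᵢ₊₁) - Y(xᵢ))` for a curve `Y` in a vector space. -/
def vectorSum (π : TaggedPartition a b) (f : ℝ → ℂ) (Y : ℝ → E) : E :=
  ∑ i : Fin π.n, f (π.tag i) • (Y (π.node i.succ) - Y (π.node i.castSucc))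

theorem vectorSum_eq_sum_range (π : TaggedPartition a b) (f : ℝ → ℂ) (Y : ℝ → E) :
    π.vectorSum f Y = ∑ k ∈ Finset.range π.n,
      f (π.natTag k) • (Y (π.natNode (k + 1)) - Y (π.natNode k)) := by
  rw [← Fin.sum_univ_eq_sum_range
    (fun k => f (π.natTag k) • (Y (π.natNode (k + 1)) - Y (π.natNode k)))]
  simp only [vectorSum, natNode_succ, natNode_castSucc, natTag_coe]

theorem vectorSum_sub_right (π : TaggedPartition a b) (f : ℝ → ℂ) (Y Z : ℝ → E) :
    π.vectorSum f (fun u => Y u - Z u) = π.vectorSum f Y - π.vectorSum f Z := by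
  simp only [vectorSum, ← Finset.sum_sub_distrib, ← smul_sub]
  refine Finset.sum_congr rfl fun i _ => ?_
  congr 1
  abel

theorem vectorSum_sub_left (π : TaggedPartition a b) (f g : ℝ → ℂ) (Y : ℝ → E) :
    π.vectorSum (fun u => f u - g u) Y = π.vectorSum f Y - π.vectorSum g Y := by
  simp only [vectorSum, ← Finset.sum_sub_distrib, ← sub_smul]

/-- Summation by parts moves the differences from `Y` to `f`: two boundary terms remain, and the
rest is controlled by the variation of `f` along the tags. The bound does not depend on the
partition. -/
theorem norm_vectorSum_le (π : TaggedPartition a b) {f : ℝ → ℂ} {Y : ℝ → E} {M C : ℝ}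
    (hM : ∀ u ∈ Icc a b, ‖f u‖ ≤ M) (hf : BoundedVariationOn f (Icc a b))
    (hC : ∀ u ∈ Icc a b, ‖Y u‖ ≤ C) :
    ‖π.vectorSum f Y‖ ≤ (2 * M + (eVariationOn f (Icc a b)).toReal) * C := by
  have hC0 : 0 ≤ C := (norm_nonneg _).trans (hC _ (π.natNode_mem 0))
  have hM0 : 0 ≤ M := (norm_nonneg _).trans (hM _ (π.natNode_mem 0))
  -- The last difference uses the default value `b` of `natTag` at index `π.n`; the extended tags
  -- are still monotone in `[a, b]`.
  have hV : ∑ i ∈ Finset.range π.n, ‖f (π.natTag (i + 1)) - f (π.natTag i)‖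
      ≤ (eVariationOn f (Icc a b)).toReal := by
    have h := eVariationOn.sum_le (f := f) (n := π.n) π.monotone_natTag π.natTag_mem
    have h' := ENNReal.toReal_mono hf h
    rw [ENNReal.toReal_sum (fun i _ => edist_ne_top _ _)] at h'
    simpa [← dist_edist, dist_eq_norm] using h'
  rw [vectorSum_eq_sum_range, sum_range_smul_sub_eq (fun k => f (π.natTag k))
    (fun k => Y (π.natNode k))]
  have hterm : ∀ k l, ‖f (π.natTag k) • Y (π.natNode l)‖ ≤ M * C := fun k l => by
    rw [norm_smul]
    exact mul_le_mul (hM _ (π.natTag_mem k)) (hC _ (π.natNode_mem l)) (norm_nonneg _) hM0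
  have hsum : ‖∑ i ∈ Finset.range π.n,
      (f (π.natTag (i + 1)) - f (π.natTag i)) • Y (π.natNode (i + 1))‖
        ≤ (eVariationOn f (Icc a b)).toReal * C := by
    refine (norm_sum_le _ _).trans ?_
    refine le_trans (Finset.sum_le_sum fun i _ => ?_)
      ((Finset.sum_mul _ _ C).ge.trans (mul_le_mul_of_nonneg_right hV hC0))
    rw [norm_smul]
    exact mul_le_mul_of_nonneg_left (hC _ (π.natNode_mem _)) (norm_nonneg _)
  calc _ ≤ ‖f (π.natTag π.n) • Y (π.natNode π.n)‖ + ‖f (π.natTag 0) • Y (π.natNode 0)‖ +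
        ‖∑ i ∈ Finset.range π.n,
          (f (π.natTag (i + 1)) - f (π.natTag i)) • Y (π.natNode (i + 1))‖ :=
        (norm_sub_le _ _).trans (add_le_add_left (norm_sub_le _ _) _)
    _ ≤ M * C + M * C + (eVariationOn f (Icc a b)).toReal * C :=
        add_le_add (add_le_add (hterm _ _) (hterm _ _)) hsum
    _ = _ := by ring

/-- When `Z` has density `G`, each cell contributes the integral of `(f(τ) - f(x)) • G x`, and the
oscillation of `f` on a cell is at most `η` once the mesh is below `δ`. -/
theorem norm_vectorSum_sub_integral_le [CompleteSpace E] (π : TaggedPartition a b)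
    {f : ℝ → ℂ} {G Z : ℝ → E} {δ η K : ℝ} (hf : Continuous f) (hG : Continuous G)
    (hZ : ∀ u v, Z v - Z u = ∫ x in u..v, G x) (hK : ∀ u ∈ Icc a b, ‖G u‖ ≤ K)
    (hδ : ∀ u ∈ Icc a b, ∀ v ∈ Icc a b, |u - v| < δ → ‖f u - f v‖ ≤ η) (hη : 0 ≤ η)
    (hπ : π.mesh < δ) :
    ‖π.vectorSum f Z - ∫ x in a..b, f x • G x‖ ≤ η * K * (b - a) := by
  have hint : ∀ u v, IntervalIntegrable (fun x => f x • G x) volume u v :=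
    fun u v => (hf.smul hG).intervalIntegrable u v
  have hsplit : ∫ x in a..b, f x • G x =
      ∑ k ∈ Finset.range π.n, ∫ x in π.natNode k..π.natNode (k + 1), f x • G x := by
    rw [intervalIntegral.sum_integral_adjacent_intervals fun k _ => hint _ _,
      π.natNode_zero, π.natNode_of_le le_rfl]
  have hlen : b - a = ∑ k ∈ Finset.range π.n, (π.natNode (k + 1) - π.natNode k) := by
    rw [Finset.sum_range_sub, π.natNode_zero, π.natNode_of_le le_rfl]
  rw [hsplit, vectorSum_eq_sum_range, ← Finset.sum_sub_distrib, hlen, Finset.mul_sum]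
  refine norm_sum_le_of_le _ fun k hk => ?_
  have hk' := Finset.mem_range.1 hk
  have hle := π.monotone_natNode (Nat.le_succ k)
  rw [hZ, ← intervalIntegral.integral_smul, ← intervalIntegral.integral_sub
    (f := fun x => f (π.natTag k) • G x)
    ((hG.const_smul _).intervalIntegrable _ _) (hint _ _)]
  refine (intervalIntegral.norm_integral_le_of_norm_le_const (C := η * K) fun x hx => ?_).trans
    (by rw [abs_of_nonneg (sub_nonneg.2 hle)])
  rw [uIoc_of_le hle] at hx
  have hxm : x ∈ Icc a b :=
    ⟨(π.natNode_mem k).1.trans hx.1.le, hx.2.trans (π.natNode_mem (k + 1)).2⟩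
  rw [← sub_smul, norm_smul]
  refine mul_le_mul (hδ _ (π.natTag_mem k) _ hxm ?_) (hK _ hxm) (norm_nonneg _) hη
  have h1 := π.natNode_le_natTag k
  have h2 := π.natTag_le_natNode k
  have h3 := π.natNode_sub_le_mesh hk'
  rw [abs_lt]
  constructor <;> linarith [hx.1, hx.2]

end TaggedPartition

/-! ### Riemann–Stieltjes integrals against uniformly continuous curves -/

section Stieltjes

variable {E : Type*} [NormedAddCommGroup E] [NormedSpace ℂ E]

/-- The difference quotient of `Y` with increment `ε`. -/
def diffQuot (Y : ℝ → E) (ε u : ℝ) : E := ε⁻¹ • (Y (u + ε) - Y u)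

/-- The average of `Y` over the interval between `u` and `u + ε`. -/
def slidingMean (Y : ℝ → E) (ε u : ℝ) : E := ε⁻¹ • ∫ x in u..u + ε, Y x

theorem continuous_diffQuot {Y : ℝ → E} (hY : Continuous Y) (ε : ℝ) :
    Continuous (diffQuot Y ε) := by
  unfold diffQuot; fun_prop

/-- The sliding mean is a primitive of the difference quotient, which makes it a regularisation of
`Y` with continuous density. -/
theorem slidingMean_sub {Y : ℝ → E} (hY : Continuous Y) (ε u v : ℝ) :
    slidingMean Y ε v - slidingMean Y ε u = ∫ x in u..v, diffQuot Y ε x := by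
  have hi : ∀ c d, IntervalIntegrable Y volume c d := fun c d => hY.intervalIntegrable c d
  have h1 : ∫ x in u..v, Y (x + ε) = ∫ x in u + ε..v + ε, Y x :=
    intervalIntegral.integral_comp_add_right _ _
  simp only [diffQuot, slidingMean]
  rw [intervalIntegral.integral_smul, intervalIntegral.integral_sub
    (Continuous.intervalIntegrable (by fun_prop) _ _) (hi _ _), h1, ← smul_sub]
  have e1 := intervalIntegral.integral_add_adjacent_intervals (hi u (u + ε)) (hi (u + ε) (v + ε))
  have e2 := intervalIntegral.integral_add_adjacent_intervals (hi u v) (hi v (v + ε))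
  congr 1
  rw [sub_eq_sub_iff_add_eq_add, add_comm (∫ x in v..v + ε, Y x), e2, ← e1, add_comm]

theorem norm_slidingMean_sub_le [CompleteSpace E] {Y : ℝ → E} (hY : Continuous Y) {ε η u : ℝ} (hε : ε ≠ 0)
    (h : ∀ x, |x - u| ≤ |ε| → ‖Y x - Y u‖ ≤ η) : ‖slidingMean Y ε u - Y u‖ ≤ η := by
  have hu : slidingMean Y ε u - Y u =
      (ε⁻¹ • ∫ x in u..u + ε, Y x) - ε⁻¹ • ∫ _x in u..u + ε, Y u := by
    simp [slidingMean, smul_smul, hε]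
  rw [hu, ← smul_sub, ← intervalIntegral.integral_sub (hY.intervalIntegrable _ _) (by simp), norm_smul]
  have := intervalIntegral.norm_integral_le_of_norm_le_const (a := u) (b := u + ε) (C := η)
    (f := fun x => Y x - Y u) fun x hx => h x ?_
  · rw [add_sub_cancel_left] at this
    rw [norm_inv, Real.norm_eq_abs]
    have hpos : 0 < |ε| := abs_pos.2 hε
    rw [inv_mul_le_iff₀ hpos]
    linarith
  · rcases abs_cases ε with ⟨h1, h2⟩ | ⟨h1, h2⟩ <;> rw [h1, abs_le] <;>
      rcases mem_uIoc.1 hx with h | h <;> constructor <;> linarith [h.1, h.2]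

/-- The order of choices matters. First `ε` is taken so small that the sliding mean is close to `Y`,
with an error uniform over partitions. Only then is the mesh chosen, in terms of a bound on the
difference quotient that depends on `ε`. -/
theorem exists_eventually_norm_vectorSum_sub_le [CompleteSpace E] {a b : ℝ} (hab : a ≤ b)
    {f : ℝ → ℂ} {Y : ℝ → E} (hf : Continuous f) (hfv : BoundedVariationOn f (Icc a b))
    (hY : UniformContinuous Y) {η : ℝ} (hη : 0 < η) :
    ∀ᶠ ε in 𝓝[≠] (0 : ℝ), ∀ᶠ π in TaggedPartition.fine a b,
      ‖π.vectorSum f Y - ∫ u in a..b, f u • diffQuot Y ε u‖ ≤ η := by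
  obtain ⟨M, hM⟩ := isCompact_Icc.exists_bound_of_continuousOn (f := f) (s := Icc a b)
    hf.continuousOn
  have hM0 : 0 ≤ M := (norm_nonneg _).trans (hM a (left_mem_Icc.2 hab))
  set V := 2 * M + (eVariationOn f (Icc a b)).toReal with hV
  have hV0 : 0 ≤ V := by positivity
  obtain ⟨δ, hδ, hYδ⟩ := Metric.uniformContinuous_iff.1 hY (η / 2 / (V + 1)) (by positivity)
  have hev : ∀ᶠ ε in 𝓝[≠] (0 : ℝ), |ε| < δ ∧ ε ≠ 0 := by
    refine Eventually.and (nhdsWithin_le_nhds ?_) self_mem_nhdsWithin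
    filter_upwards [Metric.ball_mem_nhds (0 : ℝ) hδ] with ε hε
    simpa using hε
  filter_upwards [hev] with ε hε
  have hclose : ∀ u, ‖slidingMean Y ε u - Y u‖ ≤ η / 2 / (V + 1) := fun u =>
    norm_slidingMean_sub_le hY.continuous hε.2 fun x hx => by
      rw [← dist_eq_norm]
      exact (hYδ (by rw [Real.dist_eq]; exact hx.trans_lt hε.1)).le
  obtain ⟨K, hK⟩ := isCompact_Icc.exists_bound_of_continuousOn (f := diffQuot Y ε) (s := Icc a b)
    (continuous_diffQuot hY.continuous ε).continuousOn
  have hK0 : 0 ≤ K := (norm_nonneg _).trans (hK a (left_mem_Icc.2 hab))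
  have hd : 0 < K * (b - a) + 1 := by nlinarith
  obtain ⟨r, hr, hfr⟩ := Metric.uniformContinuousOn_iff.1
    (isCompact_Icc.uniformContinuousOn_of_continuous (hf.continuousOn (s := Icc a b)))
    (η / 2 / (K * (b - a) + 1)) (by positivity)
  filter_upwards [TaggedPartition.eventually_mesh_lt hr] with π hπ
  have h1 := π.norm_vectorSum_sub_integral_le hf (continuous_diffQuot hY.continuous ε)
    (fun u v => slidingMean_sub hY.continuous ε u v) hK
    (fun u hu v hv huv => by rw [← dist_eq_norm]; exact (hfr u hu v hv huv).le)
    (by positivity) hπ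
  have h2 := π.norm_vectorSum_le hM hfv (fun u _ => hclose u)
  rw [π.vectorSum_sub_right] at h2
  have h3 : η / 2 / (K * (b - a) + 1) * K * (b - a) ≤ η / 2 := by
    rw [mul_assoc, div_mul_eq_mul_div, div_le_iff₀ hd]
    nlinarith
  have h4 : V * (η / 2 / (V + 1)) ≤ η / 2 := by
    rw [mul_div_assoc', div_le_iff₀ (by positivity)]
    nlinarith
  calc ‖π.vectorSum f Y - ∫ u in a..b, f u • diffQuot Y ε u‖
      = ‖(π.vectorSum f (slidingMean Y ε) - ∫ u in a..b, f u • diffQuot Y ε u) -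
          (π.vectorSum f (slidingMean Y ε) - π.vectorSum f Y)‖ := by congr 1; abel
    _ ≤ _ := norm_sub_le _ _
    _ ≤ η := by linarith

/-- The Riemann-Stieltjes sums of a continuous function of bounded variation against a uniformly
continuous curve converge. The limit is also that of the integrals against difference quotients,
which do not refer to partitions. -/
theorem exists_tendsto_vectorSum [CompleteSpace E] {a b : ℝ} (hab : a ≤ b)
    {f : ℝ → ℂ} {Y : ℝ → E} (hf : Continuous f) (hfv : BoundedVariationOn f (Icc a b))
    (hY : UniformContinuous Y) :
    ∃ I : E, Tendsto (fun ε => ∫ u in a..b, f u • diffQuot Y ε u) (𝓝[≠] 0) (𝓝 I) ∧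
      Tendsto (fun π : TaggedPartition a b => π.vectorSum f Y) (TaggedPartition.fine a b)
        (𝓝 I) := by
  have := TaggedPartition.fine_neBot hab
  have key := fun η (hη : (0 : ℝ) < η) =>
    exists_eventually_norm_vectorSum_sub_le hab hf hfv hY hη
  have hC : Cauchy (map (fun π : TaggedPartition a b => π.vectorSum f Y)
      (TaggedPartition.fine a b)) := by
    rw [Metric.cauchy_iff]
    refine ⟨inferInstance, fun η hη => ?_⟩
    -- One fixed `ε` suffices: all fine sums lie close to the same integral, hence to each other.
    obtain ⟨ε, hε⟩ := (key (η / 3) (by positivity)).exists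
    refine ⟨_, image_mem_map hε, ?_⟩
    rintro _ ⟨π, hπ, rfl⟩ _ ⟨π', hπ', rfl⟩
    have h1 : dist (π.vectorSum f Y) (∫ u in a..b, f u • diffQuot Y ε u) ≤ η / 3 := by
      rw [dist_eq_norm]; exact hπ
    have h2 : dist (π'.vectorSum f Y) (∫ u in a..b, f u • diffQuot Y ε u) ≤ η / 3 := by
      rw [dist_eq_norm]; exact hπ'
    linarith [dist_triangle_right (π.vectorSum f Y) (π'.vectorSum f Y)
      (∫ u in a..b, f u • diffQuot Y ε u)]
  obtain ⟨I, hI⟩ := CompleteSpace.complete hC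
  refine ⟨I, ?_, hI⟩
  rw [Metric.tendsto_nhds]
  intro η hη
  filter_upwards [key (η / 2) (by positivity)] with ε hε
  have : ‖I - ∫ u in a..b, f u • diffQuot Y ε u‖ ≤ η / 2 :=
    le_of_tendsto (Tendsto.norm (Tendsto.sub_const (show Tendsto _ _ _ from hI) _)) hε
  rw [dist_comm, dist_eq_norm]
  linarith

theorem intervalIntegral_eq_integral_of_support_subset {a b : ℝ} (hab : a ≤ b) {f : ℝ → ℂ}
    (hs : Function.support f ⊆ Icc a b) (G : ℝ → E) :
    ∫ u in a..b, f u • G u = ∫ u, f u • G u := by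
  rw [intervalIntegral.integral_of_le hab, ← integral_Icc_eq_integral_Ioc]
  refine setIntegral_eq_integral_of_forall_compl_eq_zero fun u hu => ?_
  rw [Function.notMem_support.1 fun h => hu (hs h), zero_smul]

theorem hasCompactSupport_of_support_subset_Icc {f : ℝ → ℂ} {a b : ℝ}
    (hs : Function.support f ⊆ Icc a b) : HasCompactSupport f :=
  HasCompactSupport.intro isCompact_Icc fun _ hu => Function.notMem_support.1 fun h => hu (hs h)

/-- For a compactly supported integrand, the limit of the Riemann-Stieltjes sums does not depend
on the interval. -/
theorem exists_tendsto_vectorSum_line [CompleteSpace E]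
    {f : ℝ → ℂ} {Y : ℝ → E} (hf : Continuous f) (hfc : HasCompactSupport f)
    (hfv : BoundedVariationOn f univ) (hY : UniformContinuous Y) :
    ∃ I : E, Tendsto (fun ε => ∫ u, f u • diffQuot Y ε u) (𝓝[≠] 0) (𝓝 I) ∧
      ∀ a b : ℝ, a ≤ b → Function.support f ⊆ Icc a b →
        Tendsto (fun π : TaggedPartition a b => π.vectorSum f Y) (TaggedPartition.fine a b)
          (𝓝 I) := by
  have key : ∀ a b : ℝ, a ≤ b → Function.support f ⊆ Icc a b →
      ∃ I : E, Tendsto (fun ε => ∫ u, f u • diffQuot Y ε u) (𝓝[≠] 0) (𝓝 I) ∧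
        Tendsto (fun π : TaggedPartition a b => π.vectorSum f Y) (TaggedPartition.fine a b)
          (𝓝 I) := by
    intro a b hab hs
    simpa only [intervalIntegral_eq_integral_of_support_subset hab hs] using
      exists_tendsto_vectorSum hab hf (hfv.mono (subset_univ _)) hY
  obtain ⟨R, hR⟩ := hfc.isCompact.isBounded.subset_closedBall 0
  rw [Real.closedBall_eq_Icc] at hR
  -- The maximum with `0` keeps the endpoints in order, as the radius `R` may be negative when `f`
  -- vanishes.
  obtain ⟨I, hI, -⟩ := key (0 - max R 0) (0 + max R 0) (by linarith [le_max_right R 0])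
    ((subset_tsupport f).trans (hR.trans (Icc_subset_Icc (by linarith [le_max_left R 0])
      (by linarith [le_max_left R 0]))))
  refine ⟨I, hI, fun a b hab hs => ?_⟩
  obtain ⟨J, hJ, hJ'⟩ := key a b hab hs
  rwa [tendsto_nhds_unique hI hJ]

/-- The reflected affine change of variables `u = t - s v`. -/
theorem integral_smul_diffQuot_comp (h : ℝ → ℂ) (Y : ℝ → E) (t : ℝ) {s : ℝ} (hs : 0 < s) (ε : ℝ) :
    ∫ u, h ((t - u) / s) • diffQuot Y ε u =
      ∫ v, h v • diffQuot (fun v => Y t - Y (t - s * v)) (-ε / s) v := by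
  -- The factor `s⁻¹` is cancelled by the Jacobian `s` of the substitution.
  set F : ℝ → E := fun v => h v • (s⁻¹ • diffQuot (fun v => Y t - Y (t - s * v)) (-ε / s) v)
    with hF
  have hFu : ∀ u, h ((t - u) / s) • diffQuot Y ε u = F ((t - u) / s) := by
    intro u
    have e1 : t - s * ((t - u) / s) = u := by field_simp; ring
    have e2 : t - s * ((t - u) / s + -ε / s) = u + ε := by field_simp; ring
    have e3 : s⁻¹ * (-ε / s)⁻¹ = -ε⁻¹ := by
      rcases eq_or_ne ε 0 with rfl | hε
      · simp
      · field_simp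
    simp only [hF, diffQuot, e1, e2]
    rw [smul_smul s⁻¹, e3, neg_smul, ← smul_neg]
    congr 2
    abel
  simp only [hFu]
  rw [integral_sub_left_eq_self (fun x => F (x / s)) volume t, Measure.integral_comp_div F s,
    abs_of_pos hs, ← integral_smul]
  refine integral_congr_ae (ae_of_all _ fun v => ?_)
  simp only [hF]
  rw [smul_comm s, smul_smul s, mul_inv_cancel₀ hs.ne', one_smul]

theorem tendsto_neg_mul_nhdsNE_zero {s : ℝ} (hs : s ≠ 0) :
    Tendsto (fun ε : ℝ => -ε * s) (𝓝[≠] 0) (𝓝[≠] 0) := by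
  refine tendsto_nhdsWithin_iff.2 ⟨?_, ?_⟩
  · have : Tendsto (fun ε : ℝ => -ε * s) (𝓝 0) (𝓝 (-0 * s)) :=
      Continuous.tendsto (by fun_prop) 0
    simp only [neg_zero, zero_mul] at this
    exact this.mono_left nhdsWithin_le_nhds
  · filter_upwards [self_mem_nhdsWithin] with ε hε
    simpa [hs] using hε

end Stieltjes

/-! ### Variation of modulated windows and dependence on the frequency -/

section ModulatedWindow

/-- The window `w` modulated at frequency `l`. -/
def modulate (w : ℝ → ℂ) (l u : ℝ) : ℂ := w u * Complex.exp (Complex.I * l * u)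

theorem continuous_modulate {w : ℝ → ℂ} (hw : Continuous w) (l : ℝ) :
    Continuous (modulate w l) := by
  unfold modulate; fun_prop

theorem support_modulate_subset (w : ℝ → ℂ) (l : ℝ) :
    Function.support (modulate w l) ⊆ Function.support w :=
  Function.support_mul_subset_left _ _

theorem norm_exp_I_mul (x : ℝ) : ‖Complex.exp (Complex.I * x)‖ = 1 := by
  rw [mul_comm]; exact Complex.norm_exp_ofReal_mul_I x

theorem norm_exp_I_mul_sub_exp_I_mul_le (x y : ℝ) :
    ‖Complex.exp (Complex.I * x) - Complex.exp (Complex.I * y)‖ ≤ |x - y| := by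
  have h : Complex.exp (Complex.I * x) - Complex.exp (Complex.I * y) =
      Complex.exp (Complex.I * y) * (Complex.exp (Complex.I * ((x - y : ℝ) : ℂ)) - 1) := by
    rw [mul_sub, ← Complex.exp_add, mul_one]
    congr 2
    push_cast
    ring
  rw [h, norm_mul, norm_exp_I_mul, one_mul]
  exact Real.norm_exp_I_mul_ofReal_sub_one_le

theorem norm_exp_sub_exp_le {l m u : ℝ} (hu : u ∈ Icc (0 : ℝ) 1) :
    ‖Complex.exp (Complex.I * l * u) - Complex.exp (Complex.I * m * u)‖ ≤ |l - m| := by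
  have h := norm_exp_I_mul_sub_exp_I_mul_le (l * u) (m * u)
  push_cast at h
  rw [← mul_assoc, ← mul_assoc] at h
  refine h.trans ?_
  rw [← sub_mul, abs_mul, abs_of_nonneg hu.1]
  exact mul_le_of_le_one_right (abs_nonneg _) hu.2

theorem lipschitzOnWith_exp_sub_exp (l m : ℝ) :
    LipschitzOnWith (Real.toNNReal ((1 + |m|) * |l - m|))
      (fun u : ℝ => Complex.exp (Complex.I * l * u) - Complex.exp (Complex.I * m * u))
      (Icc 0 1) := by
  refine LipschitzOnWith.of_dist_le_mul fun u hu v hv => ?_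
  rw [Real.coe_toNNReal _ (by positivity), dist_eq_norm, Real.dist_eq]
  have hsplit : ∀ x : ℝ, Complex.exp (Complex.I * l * x) =
      Complex.exp (Complex.I * ((m * x : ℝ) : ℂ)) *
        Complex.exp (Complex.I * (((l - m) * x : ℝ) : ℂ)) := fun x => by
    rw [← Complex.exp_add]; congr 1; push_cast; ring
  have hm : ∀ x : ℝ, Complex.exp (Complex.I * m * x) =
      Complex.exp (Complex.I * ((m * x : ℝ) : ℂ)) := fun x => by
    congr 1; push_cast; ring
  set A : ℝ → ℂ := fun x => Complex.exp (Complex.I * ((m * x : ℝ) : ℂ)) with hA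
  set B : ℝ → ℂ := fun x => Complex.exp (Complex.I * (((l - m) * x : ℝ) : ℂ)) with hB
  have h1 : ‖A u‖ = 1 := norm_exp_I_mul _
  have h2 : ‖B u - B v‖ ≤ |l - m| * |u - v| := by
    refine (norm_exp_I_mul_sub_exp_I_mul_le _ _).trans ?_
    rw [← mul_sub, abs_mul]
  have h3 : ‖A u - A v‖ ≤ |m| * |u - v| := by
    refine (norm_exp_I_mul_sub_exp_I_mul_le _ _).trans ?_
    rw [← mul_sub, abs_mul]
  have h4 : ‖B v - 1‖ ≤ |l - m| := by
    refine (Real.norm_exp_I_mul_ofReal_sub_one_le (x := (l - m) * v)).trans ?_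
    rw [Real.norm_eq_abs, abs_mul, abs_of_nonneg hv.1]
    exact mul_le_of_le_one_right (abs_nonneg _) hv.2
  calc ‖Complex.exp (Complex.I * l * u) - Complex.exp (Complex.I * m * u) -
          (Complex.exp (Complex.I * l * v) - Complex.exp (Complex.I * m * v))‖
      -- The function is `A * (B - 1)`, so the product rule for differences gives a factor `|l - m|`
      -- in both terms.
      = ‖A u * (B u - B v) + (A u - A v) * (B v - 1)‖ := by
        rw [hsplit, hsplit, hm, hm]; congr 1; ring
    _ ≤ ‖A u‖ * ‖B u - B v‖ + ‖A u - A v‖ * ‖B v - 1‖ := by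
        refine (norm_add_le _ _).trans ?_
        rw [norm_mul, norm_mul]
    _ ≤ 1 * (|l - m| * |u - v|) + (|m| * |u - v|) * |l - m| := by
        rw [h1]
        gcongr
    _ = _ := by ring

/-- The variation of `w (e^{ilu} - e^{imu})` is at most a constant times `|l - m|`. -/
theorem eVariationOn_modulate_sub_le {w : ℝ → ℂ} {M : ℝ} (hM : ∀ u ∈ Icc (0 : ℝ) 1, ‖w u‖ ≤ M)
    (l m : ℝ) :
    eVariationOn (fun u => modulate w l u - modulate w m u) (Icc 0 1) ≤
      ENNReal.ofReal M * ENNReal.ofReal ((1 + |m|) * |l - m|) +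
        ENNReal.ofReal |l - m| * eVariationOn w (Icc 0 1) := by
  have h := eVariationOn_smul_le (s := Icc (0 : ℝ) 1) (f := w)
    (g := fun u : ℝ => Complex.exp (Complex.I * l * u) - Complex.exp (Complex.I * m * u))
    (C := ENNReal.ofReal M) (D := ENNReal.ofReal |l - m|)
    (fun u hu => by rw [← ofReal_norm]; exact ENNReal.ofReal_le_ofReal (hM u hu))
    (fun u hu => by rw [← ofReal_norm]; exact ENNReal.ofReal_le_ofReal (norm_exp_sub_exp_le hu))
  have h' := (lipschitzOnWith_exp_sub_exp l m).comp_eVariationOn_le (f := _) (g := id)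
    (s := Icc (0 : ℝ) 1) (fun x hx => hx)
  rw [eVariationOn_id_Icc, sub_zero, ENNReal.ofReal_one, mul_one] at h'
  refine le_trans (le_of_eq ?_) (h.trans (by gcongr; exact h'))
  refine eVariationOn.congr fun u _ => ?_
  simp only [modulate, Pi.smul_apply', smul_eq_mul]
  ring

theorem boundedVariationOn_modulate {w : ℝ → ℂ} (hw : BoundedVariationOn w (Icc 0 1)) (l : ℝ) :
    BoundedVariationOn (modulate w l) (Icc 0 1) := by
  have hL : LipschitzOnWith (Real.toNNReal |l|) (fun u : ℝ => Complex.exp (Complex.I * l * u))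
      (Icc 0 1) := by
    refine LipschitzOnWith.of_dist_le_mul fun u _ v _ => ?_
    rw [Real.coe_toNNReal _ (abs_nonneg _), dist_eq_norm, Real.dist_eq, ← abs_mul, mul_sub]
    have h := norm_exp_I_mul_sub_exp_I_mul_le (l * u) (l * v)
    push_cast at h
    rwa [← mul_assoc, ← mul_assoc] at h
  exact hw.smul (hL.comp_boundedVariationOn (fun x hx => hx) (BoundedVariationOn.id_Icc 0 1))

/-- A continuous function that vanishes off an interval has bounded variation on the line if it
has bounded variation on the interval. -/
theorem boundedVariationOn_univ_of_support_subset {h : ℝ → ℂ} {a b : ℝ} (hab : a ≤ b)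
    (hc : Continuous h) (hs : Function.support h ⊆ Icc a b)
    (hv : BoundedVariationOn h (Icc a b)) : BoundedVariationOn h univ := by
  -- By continuity the support is open, so it avoids the endpoints. Hence `h` is unchanged by
  -- projecting onto `[a, b]`, and a monotone reparametrisation does not increase variation.
  have hout : ∀ u, u ∉ Ioo a b → h u = 0 := by
    have hsub : Function.support h ⊆ Ioo a b := by
      rw [← interior_Icc]
      exact interior_maximal hs hc.isOpen_support
    exact fun u hu => Function.notMem_support.1 fun h' => hu (hsub h')
  have hcl : h = h ∘ fun u => (projIcc a b hab u : ℝ) := by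
    funext u
    rcases le_total u a with hu | hu
    · rw [Function.comp_apply, projIcc_of_le_left hab hu, hout _ fun h => h.1.not_ge hu,
        hout _ fun h => h.1.false]
    rcases le_total b u with hu' | hu'
    · rw [Function.comp_apply, projIcc_of_right_le hab hu', hout _ fun h => h.2.not_ge hu',
        hout _ fun h => h.2.false]
    · rw [Function.comp_apply, projIcc_of_mem hab ⟨hu, hu'⟩]
  rw [hcl]
  exact ne_top_of_le_ne_top hv (eVariationOn.comp_le_of_monotoneOn h _
    (fun x _ y _ hxy => monotone_projIcc hab hxy) fun u _ => (projIcc a b hab u).2)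

theorem gaborFilter_sub_eq (w : ℝ → ℂ) {s : ℝ} (hs : s ≠ 0) (ξ t u : ℝ) :
    gaborFilter w (s, ξ) (t - u) = modulate w (s * ξ) ((t - u) / s) := by
  have : (s : ℂ) ≠ 0 := by exact_mod_cast hs
  simp only [gaborFilter, modulate]
  congr 2
  push_cast
  field_simp

theorem boundedVariationOn_comp_reflect {h : ℝ → ℂ} (hv : BoundedVariationOn h univ) (t : ℝ)
    {s : ℝ} (hs : 0 < s) : BoundedVariationOn (fun u => h ((t - u) / s)) univ :=
  ne_top_of_le_ne_top hv (eVariationOn.comp_le_of_antitoneOn h (fun u => (t - u) / s)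
    (fun x _ y _ hxy => by dsimp only; gcongr) fun _ _ => mem_univ _)

theorem support_comp_reflect_subset {h : ℝ → ℂ} (hsupp : Function.support h ⊆ Icc 0 1) (t : ℝ)
    {s : ℝ} (hs : 0 < s) :
    Function.support (fun u => h ((t - u) / s)) ⊆ Icc (t - s) t := by
  intro u hu
  have := hsupp (show (t - u) / s ∈ Function.support h from hu)
  have h1 := this.1
  have h2 := this.2
  rw [le_div_iff₀ hs] at h1
  rw [div_le_one hs] at h2
  constructor <;> linarith

variable {E : Type*} [NormedAddCommGroup E] [NormedSpace ℂ E]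

/-- The Riemann-Stieltjes integral of a modulated window depends continuously on the frequency. -/
theorem tendsto_of_tendsto_vectorSum_modulate {w : ℝ → ℂ} (hwc : Continuous w)
    (hwv : BoundedVariationOn w (Icc 0 1)) {Y : ℝ → E} (hY : Continuous Y) {l : ℕ → ℝ} {L : ℝ}
    (hl : Tendsto l atTop (𝓝 L)) {I : ℕ → E} {J : E}
    (hI : ∀ k, Tendsto (fun π : TaggedPartition 0 1 => π.vectorSum (modulate w (l k)) Y)
      (TaggedPartition.fine 0 1) (𝓝 (I k)))
    (hJ : Tendsto (fun π : TaggedPartition 0 1 => π.vectorSum (modulate w L) Y)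
      (TaggedPartition.fine 0 1) (𝓝 J)) :
    Tendsto I atTop (𝓝 J) := by
  have := TaggedPartition.fine_neBot (zero_le_one' ℝ)
  obtain ⟨M, hM⟩ := isCompact_Icc.exists_bound_of_continuousOn (f := w) (s := Icc 0 1)
    hwc.continuousOn
  have hM0 : 0 ≤ M := (norm_nonneg _).trans (hM 0 (by simp))
  obtain ⟨C, hC⟩ := isCompact_Icc.exists_bound_of_continuousOn (f := Y) (s := Icc 0 1)
    hY.continuousOn
  have hC0 : 0 ≤ C := (norm_nonneg _).trans (hC 0 (by simp))
  set W := (eVariationOn w (Icc 0 1)).toReal with hW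
  have hbound : ∀ k, ‖I k - J‖ ≤
      (2 * (M * |l k - L|) + (M * ((1 + |L|) * |l k - L|) + |l k - L| * W)) * C := by
    intro k
    have hvar := eVariationOn_modulate_sub_le hM (l k) L
    have htop : ENNReal.ofReal M * ENNReal.ofReal ((1 + |L|) * |l k - L|) +
        ENNReal.ofReal |l k - L| * eVariationOn w (Icc 0 1) ≠ ⊤ :=
      ENNReal.add_ne_top.2 ⟨ENNReal.mul_ne_top ENNReal.ofReal_ne_top ENNReal.ofReal_ne_top,
        ENNReal.mul_ne_top ENNReal.ofReal_ne_top hwv⟩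
    have hvar' := ENNReal.toReal_mono htop hvar
    rw [ENNReal.toReal_add
      (ENNReal.mul_ne_top ENNReal.ofReal_ne_top ENNReal.ofReal_ne_top)
      (ENNReal.mul_ne_top ENNReal.ofReal_ne_top hwv), ENNReal.toReal_mul, ENNReal.toReal_mul,
      ENNReal.toReal_ofReal hM0, ENNReal.toReal_ofReal (by positivity),
      ENNReal.toReal_ofReal (abs_nonneg _)] at hvar'
    refine le_of_tendsto ((hI k).sub hJ).norm (Eventually.of_forall fun π => ?_)
    rw [← π.vectorSum_sub_left]
    refine (π.norm_vectorSum_le (M := M * |l k - L|) (fun u hu => ?_)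
      (ne_top_of_le_ne_top htop hvar) hC).trans (by gcongr)
    rw [modulate, modulate, ← mul_sub, norm_mul]
    exact mul_le_mul (hM u hu) (norm_exp_sub_exp_le hu) (norm_nonneg _) hM0
  rw [tendsto_iff_norm_sub_tendsto_zero]
  refine squeeze_zero (fun _ => norm_nonneg _) hbound ?_
  have hd : Tendsto (fun k => |l k - L|) atTop (𝓝 0) := by
    simpa using (hl.sub_const L).abs
  have hcont : Continuous fun d : ℝ =>
      (2 * (M * d) + (M * ((1 + |L|) * d) + d * W)) * C := by fun_prop
  simpa [Function.comp_def] using (hcont.tendsto 0).comp hd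

end ModulatedWindow

/-! ### Stochastic integrals as limits in L^q -/

section LpCurve

variable {Ω : Type*} [MeasurableSpace Ω] {P : Measure Ω} {q : ENNReal}

theorem coeFn_finset_sum_Lp {ι : Type*} (s : Finset ι) (F : ι → Lp ℂ q P) :
    ⇑(∑ i ∈ s, F i) =ᵐ[P] fun ω => ∑ i ∈ s, F i ω := by
  classical
  induction s using Finset.induction_on with
  | empty =>
    simp only [Finset.sum_empty]
    exact Lp.coeFn_zero ℂ q P
  | insert i s hi ih =>
    rw [Finset.sum_insert hi]
    filter_upwards [Lp.coeFn_add (F i) (∑ j ∈ s, F j), ih] with ω h1 h2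
    rw [h1, Pi.add_apply, h2, Finset.sum_insert hi]

/-- A real process with finite moments, as a curve in a complex `L^q` space. -/
def lpCurve {X : ℝ → Ω → ℝ} (hX : ∀ t, MemLp (fun ω => (X t ω : ℂ)) q P) (t : ℝ) : Lp ℂ q P :=
  (hX t).toLp _

theorem coeFn_vectorSum_lpCurve {X : ℝ → Ω → ℝ} (hX : ∀ t, MemLp (fun ω => (X t ω : ℂ)) q P)
    [Fact (1 ≤ q)] {a b : ℝ} (π : TaggedPartition a b) (f : ℝ → ℂ) :
    ⇑(π.vectorSum f (lpCurve hX)) =ᵐ[P] fun ω => π.riemannSum f (fun u => X u ω) := by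
  have hterm : ∀ i : Fin π.n, ⇑(f (π.tag i) •
      (lpCurve hX (π.node i.succ) - lpCurve hX (π.node i.castSucc))) =ᵐ[P] fun ω =>
        f (π.tag i) * ((X (π.node i.succ) ω - X (π.node i.castSucc) ω : ℝ) : ℂ) := by
    intro i
    filter_upwards [Lp.coeFn_smul (f (π.tag i))
      (lpCurve hX (π.node i.succ) - lpCurve hX (π.node i.castSucc)),
      Lp.coeFn_sub (lpCurve hX (π.node i.succ)) (lpCurve hX (π.node i.castSucc)),
      (hX (π.node i.succ)).coeFn_toLp, (hX (π.node i.castSucc)).coeFn_toLp] with ω h1 h2 h3 h4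
    rw [h1, Pi.smul_apply, h2, Pi.sub_apply, lpCurve, lpCurve, h3, h4, smul_eq_mul]
    push_cast
    rfl
  filter_upwards [coeFn_finset_sum_Lp Finset.univ (fun i : Fin π.n => f (π.tag i) •
      (lpCurve hX (π.node i.succ) - lpCurve hX (π.node i.castSucc))),
    ae_all_iff.2 hterm] with ω h1 h2
  rw [TaggedPartition.vectorSum, h1]
  exact Finset.sum_congr rfl fun i _ => h2 i

theorem isStochIntegral_of_tendsto_vectorSum {X : ℝ → Ω → ℝ}
    (hX : ∀ t, MemLp (fun ω => (X t ω : ℂ)) q P) [Fact (1 ≤ q)] {f : ℝ → ℂ} {a b : ℝ}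
    {I : Lp ℂ q P} (hI : Tendsto (fun π : TaggedPartition a b => π.vectorSum f (lpCurve hX))
      (TaggedPartition.fine a b) (𝓝 I)) :
    IsStochIntegral P X f a b I :=
  ⟨(Lp.aestronglyMeasurable I).aemeasurable,
    (tendstoInMeasure_of_tendsto_Lp hI).congr_left fun π => coeFn_vectorSum_lpCurve hX π f⟩

/-- Limits in measure along a nontrivial, countably generated filter are almost surely unique; `a ≤
b` provides the uniform partitions that make `fine a b` nontrivial. -/
theorem IsStochIntegral.ae_eq {X : ℝ → Ω → ℝ} {f : ℝ → ℂ} {a b : ℝ} (hab : a ≤ b) {Z W : Ω → ℂ}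
    (hZ : IsStochIntegral P X f a b Z) (hW : IsStochIntegral P X f a b W) : Z =ᵐ[P] W := by
  have := TaggedPartition.fine_neBot hab
  exact tendstoInMeasure_ae_unique hZ.2 hW.2

theorem stochIntegral_spec {X : ℝ → Ω → ℝ} {f : ℝ → ℂ} {a b : ℝ}
    (h : ∃ Z, IsStochIntegral P X f a b Z) :
    IsStochIntegral P X f a b (stochIntegral P X f a b) := by
  rw [stochIntegral, dif_pos h]
  exact h.choose_spec

theorem stochIntegralLine_spec {X : ℝ → Ω → ℝ} {f : ℝ → ℂ}
    (h : ∃ Z, IsStochIntegralLine P X f Z) :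
    IsStochIntegralLine P X f (stochIntegralLine P X f) := by
  rw [stochIntegralLine, dif_pos h]
  exact h.choose_spec

theorem integrable_norm_rpow_of_ae_eq_Lp {p : ℝ} (hp : 1 ≤ p) {Z : Ω → ℂ}
    {I : Lp ℂ (ENNReal.ofReal p) P} (hZ : Z =ᵐ[P] I) :
    Integrable (fun ω => ‖Z ω‖ ^ p) P := by
  have h := ((memLp_congr_ae hZ).2 (Lp.memLp I)).integrable_norm_rpow
    (by simpa using zero_lt_one.trans_le hp) ENNReal.ofReal_ne_top
  rwa [ENNReal.toReal_ofReal (by linarith)] at h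

theorem integral_norm_rpow_of_ae_eq_Lp {p : ℝ} (hp : 1 ≤ p) {Z : Ω → ℂ}
    {I : Lp ℂ (ENNReal.ofReal p) P} (hZ : Z =ᵐ[P] I) :
    ∫ ω, ‖Z ω‖ ^ p ∂P = ‖I‖ ^ p := by
  have hp0 : 0 < p := by linarith
  have h0 : 0 ≤ ∫ ω, ‖I ω‖ ^ p ∂P := integral_nonneg fun ω => by positivity
  have h1 : ∫ ω, ‖Z ω‖ ^ p ∂P = ∫ ω, ‖I ω‖ ^ p ∂P :=
    integral_congr_ae (hZ.mono fun ω h => by simp only [h])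
  rw [h1, Lp.norm_def, (Lp.memLp I).eLpNorm_eq_integral_rpow_norm (by simpa using hp0)
    ENNReal.ofReal_ne_top, ENNReal.toReal_ofReal hp0.le, ENNReal.toReal_ofReal (by positivity),
    ← Real.rpow_mul h0, inv_mul_cancel₀ hp0.ne', Real.rpow_one]

end LpCurve

/-! ### Identification of Gaussian laws -/

section GaussianLaw

variable {Ω : Type*} [MeasurableSpace Ω] {P : Measure Ω}

/-- The law of a finite-dimensional Gaussian vector is determined by means and covariances. -/
theorem map_toLp_eq_of_covariance_eq {ι : Type*} [Fintype ι] {U V : ι → Ω → ℝ}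
    (hU : HasGaussianLaw (fun ω i => U i ω) P) (hV : HasGaussianLaw (fun ω i => V i ω) P)
    (hm : ∀ i, ∫ ω, U i ω ∂P = ∫ ω, V i ω ∂P)
    (hc : ∀ i j, covariance (U i) (U j) P = covariance (V i) (V j) P) :
    P.map (fun ω => WithLp.toLp 2 (fun i => U i ω)) =
      P.map (fun ω => WithLp.toLp 2 (fun i => V i ω)) := by
  have := hU.isProbabilityMeasure
  have hU2 := hU.toLp_pi (E := fun _ : ι => ℝ) 2
  have hV2 := hV.toLp_pi (E := fun _ : ι => ℝ) 2
  have := hU2.isGaussian_map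
  have := hV2.isGaussian_map
  have mean : ∀ {W : ι → Ω → ℝ}, HasGaussianLaw (fun ω i => W i ω) P →
      ∫ x, id x ∂(P.map (fun ω => WithLp.toLp 2 (fun i => W i ω))) =
        WithLp.toLp 2 fun i => ∫ ω, W i ω ∂P := by
    intro W hW
    have hW2 := hW.toLp_pi (E := fun _ : ι => ℝ) 2
    rw [integral_map hW2.aemeasurable aestronglyMeasurable_id]
    ext i
    exact ((EuclideanSpace.proj (𝕜 := ℝ) i).integral_comp_comm hW2.integrable).symm
  apply IsGaussian.ext
  · rw [mean hU, mean hV]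
    simp only [hm]
  · rw [← ContinuousLinearMap.toBilinForm_inj]
    refine LinearMap.BilinForm.ext_basis (EuclideanSpace.basisFun ι ℝ).toBasis fun i j => ?_
    simp only [ContinuousLinearMap.toBilinForm_apply, OrthonormalBasis.coe_toBasis]
    rw [covarianceBilin_apply_basisFun fun i => (hU.eval i).memLp_two,
      covarianceBilin_apply_basisFun fun i => (hV.eval i).memLp_two, hc]

end GaussianLaw

/-! ### Regularity, self-similarity and stationary increments -/

namespace IsFractionalBrownianMotion

variable {Ω : Type*} [MeasurableSpace Ω] {P : Measure Ω} {H : ℝ} {X : ℝ → Ω → ℝ}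

theorem memLp_two (hX : IsFractionalBrownianMotion P H X) (t : ℝ) : MemLp (X t) 2 P :=
  (hX.isGaussianProcess.hasGaussianLaw_eval t).memLp_two

theorem memLp_ofReal (hX : IsFractionalBrownianMotion P H X) {q : ENNReal} (hq : q ≠ ⊤) (t : ℝ) :
    MemLp (fun ω => (X t ω : ℂ)) q P :=
  ((hX.isGaussianProcess.hasGaussianLaw_eval t).memLp hq).ofReal

theorem covariance_increment (hX : IsFractionalBrownianMotion P H X) (a b c d : ℝ) :
    covariance (fun ω => X b ω - X a ω) (fun ω => X d ω - X c ω) P =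
      (|d - a| ^ (2 * H) + |c - b| ^ (2 * H) - |d - b| ^ (2 * H) - |c - a| ^ (2 * H)) / 2 := by
  have := hX.isGaussianProcess.isProbabilityMeasure
  rw [covariance_fun_sub_fun_sub (hX.memLp_two b) (hX.memLp_two a) (hX.memLp_two d)
    (hX.memLp_two c)]
  simp only [hX.covariance_eq]
  ring

theorem integral_increment (hX : IsFractionalBrownianMotion P H X) (a b : ℝ) :
    ∫ ω, (X b ω - X a ω) ∂P = 0 := by
  have := hX.isGaussianProcess.isProbabilityMeasure
  rw [integral_sub ((hX.memLp_two b).integrable one_le_two)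
    ((hX.memLp_two a).integrable one_le_two), hX.integral_eq_zero, hX.integral_eq_zero, sub_zero]

/-- The law of an increment over a time `t - r` is that of `|t - r|^H` times a standard normal
variable. -/
theorem map_increment (hX : IsFractionalBrownianMotion P H X) (hH : 0 < H) (r t : ℝ) :
    P.map (fun ω => X t ω - X r ω) = (gaussianReal 0 1).map (|t - r| ^ H * ·) := by
  have hG := hX.isGaussianProcess.hasGaussianLaw_fun_sub (s := t) (t := r)
  rw [hG.map_eq_gaussianReal, hX.integral_increment, gaussianReal_map_const_mul, mul_zero, mul_one,
    ← covariance_self hG.aemeasurable, hX.covariance_increment]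
  congr 1
  ext
  have h2H : 2 * H ≠ 0 := by positivity
  have hsq : (|t - r| ^ H) ^ 2 = |t - r| ^ (2 * H) := by
    rw [mul_comm, Real.rpow_mul (abs_nonneg _), Real.rpow_two]
  rw [Real.coe_toNNReal']
  simp only [NNReal.coe_mk, sub_self, abs_zero, Real.zero_rpow h2H, abs_sub_comm r t, hsq]
  rw [sub_zero, sub_zero, add_self_div_two, max_eq_left (by positivity)]

theorem eLpNorm_increment (hX : IsFractionalBrownianMotion P H X) (hH : 0 < H) (q : ENNReal)
    (r t : ℝ) :
    eLpNorm (fun ω => X t ω - X r ω) q P =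
      ENNReal.ofReal (|t - r| ^ H) * eLpNorm id q (gaussianReal 0 1) := by
  have hG := hX.isGaussianProcess.hasGaussianLaw_fun_sub (s := t) (t := r)
  have h1 : eLpNorm (fun ω => X t ω - X r ω) q P =
      eLpNorm id q (P.map fun ω => X t ω - X r ω) :=
    (eLpNorm_map_measure aestronglyMeasurable_id hG.aemeasurable).symm
  rw [h1, hX.map_increment hH, eLpNorm_map_measure aestronglyMeasurable_id (by fun_prop)]
  have h2 : (id ∘ fun x : ℝ => |t - r| ^ H * x) = (|t - r| ^ H) • id := by
    funext x; simp
  rw [h2, eLpNorm_const_smul, Real.enorm_eq_ofReal (by positivity)]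

/-- As a curve in `L^q`, fractional Brownian motion is uniformly continuous. -/
theorem uniformContinuous_lpCurve (hX : IsFractionalBrownianMotion P H X) (hH : 0 < H)
    {q : ENNReal} [Fact (1 ≤ q)] (hq : q ≠ ⊤) :
    UniformContinuous (lpCurve fun t => hX.memLp_ofReal hq t) := by
  set K := (eLpNorm id q (gaussianReal 0 1)).toReal with hK
  have hdist : ∀ r t, dist (lpCurve (fun t => hX.memLp_ofReal hq t) t)
      (lpCurve (fun t => hX.memLp_ofReal hq t) r) = |t - r| ^ H * K := by
    intro r t
    rw [dist_eq_norm, lpCurve, lpCurve, ← MemLp.toLp_sub, Lp.norm_toLp]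
    have : eLpNorm ((fun ω => (X t ω : ℂ)) - fun ω => (X r ω : ℂ)) q P =
        eLpNorm (fun ω => X t ω - X r ω) q P :=
      eLpNorm_congr_norm_ae (ae_of_all _ fun ω => by
        rw [Pi.sub_apply, ← Complex.ofReal_sub, Complex.norm_real])
    rw [this, hX.eLpNorm_increment hH, ENNReal.toReal_mul, ENNReal.toReal_ofReal (by positivity)]
  have hlim : Tendsto (fun d : ℝ => |d| ^ H * K) (𝓝 0) (𝓝 0) := by
    have hc : Continuous fun d : ℝ => |d| ^ H * K :=
      (continuous_abs.rpow_const fun _ => Or.inr hH.le).mul_const _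
    simpa [Real.zero_rpow hH.ne'] using hc.tendsto 0
  rw [Metric.uniformContinuous_iff]
  intro η hη
  obtain ⟨δ, hδ, h⟩ := Metric.tendsto_nhds_nhds.1 hlim η hη
  refine ⟨δ, hδ, fun {r t} hrt => ?_⟩
  rw [hdist]
  have := h (x := r - t) (by simpa [Real.dist_eq] using hrt)
  rw [Real.dist_eq, sub_zero] at this
  exact (le_abs_self _).trans_lt this

/-- The increments of the reflected and scaled process `v ↦ X (t - s v)` have the law of those of
`s^H X`, up to a sign that does not affect norms. -/
theorem eLpNorm_riemannSum_reflect (hX : IsFractionalBrownianMotion P H X) {s : ℝ} (hs : 0 < s)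
    (t : ℝ) (q : ENNReal) {a b : ℝ} (π : TaggedPartition a b) (f : ℝ → ℂ) :
    eLpNorm (fun ω => π.riemannSum f (fun v => X (t - s * v) ω)) q P =
      ENNReal.ofReal (s ^ H) * eLpNorm (fun ω => π.riemannSum f (fun v => X v ω)) q P := by
  have := hX.isGaussianProcess.isProbabilityMeasure
  set U : Fin π.n → Ω → ℝ :=
    fun i ω => X (t - s * π.node i.succ) ω - X (t - s * π.node i.castSucc) ω with hU
  set D : Fin π.n → Ω → ℝ := fun i ω => X (π.node i.succ) ω - X (π.node i.castSucc) ω with hD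
  set V : Fin π.n → Ω → ℝ := fun i ω => s ^ H * D i ω with hV
  have hUg : HasGaussianLaw (fun ω i => U i ω) P :=
    hX.isGaussianProcess.hasGaussianLaw_increments (t := fun i => t - s * π.node i)
  have hVg : HasGaussianLaw (fun ω i => V i ω) P :=
    (hX.isGaussianProcess.hasGaussianLaw_increments (t := π.node)).fun_smul (s ^ H)
  have hmap := map_toLp_eq_of_covariance_eq hUg hVg
    (fun i => by
      simp only [hU, hV, hD]
      rw [integral_const_mul, hX.integral_increment, hX.integral_increment, mul_zero])
    (fun i j => by
      simp only [hU, hV, hD]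
      rw [covariance_const_mul_left, covariance_const_mul_right, hX.covariance_increment,
        hX.covariance_increment]
      -- Increment covariances involve only time differences, and reflection, translation and
      -- scaling multiply each `|x - y| ^ (2 * H)` by `s ^ (2 * H)`.
      have hsc : ∀ x y : ℝ, |t - s * x - (t - s * y)| ^ (2 * H) =
          s ^ H * (s ^ H * |x - y| ^ (2 * H)) := by
        intro x y
        have : t - s * x - (t - s * y) = s * (y - x) := by ring
        rw [this, abs_mul, abs_of_pos hs, Real.mul_rpow hs.le (abs_nonneg _), abs_sub_comm,
          ← mul_assoc, ← Real.rpow_add hs, two_mul]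
      simp only [hsc]
      ring)
  -- Both Riemann sums are the same linear image `g` of vectors of increments with equal laws.
  set g : EuclideanSpace ℝ (Fin π.n) → ℂ := fun z => ∑ i, f (π.tag i) * ((z i : ℝ) : ℂ) with hg
  have hgc : Continuous g := by
    refine continuous_finsetSum _ fun i _ => continuous_const.mul ?_
    exact Complex.continuous_ofReal.comp (EuclideanSpace.proj (𝕜 := ℝ) i).continuous
  have hUm := (hUg.toLp_pi (E := fun _ => ℝ) 2).aemeasurable
  have hVm := (hVg.toLp_pi (E := fun _ => ℝ) 2).aemeasurable
  have hUe : (fun ω => π.riemannSum f (fun v => X (t - s * v) ω)) =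
      g ∘ fun ω => WithLp.toLp 2 fun i => U i ω := rfl
  have hVe : ((s ^ H : ℝ) • fun ω => π.riemannSum f (fun v => X v ω)) =
      g ∘ fun ω => WithLp.toLp 2 fun i => V i ω := by
    funext ω
    simp only [Pi.smul_apply, TaggedPartition.riemannSum, Function.comp_apply, hg, hV, hD,
      Finset.smul_sum, Complex.real_smul]
    refine Finset.sum_congr rfl fun i _ => ?_
    push_cast
    ring
  rw [hUe, ← eLpNorm_map_measure hgc.aestronglyMeasurable hUm, hmap,
    eLpNorm_map_measure hgc.aestronglyMeasurable hVm, ← hVe, eLpNorm_const_smul,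
    Real.enorm_eq_ofReal (by positivity)]

theorem norm_vectorSum_reflect (hX : IsFractionalBrownianMotion P H X) {s : ℝ} (hs : 0 < s)
    (t : ℝ) {q : ENNReal} [Fact (1 ≤ q)] (hq : q ≠ ⊤) {a b : ℝ} (π : TaggedPartition a b)
    (f : ℝ → ℂ) {Y : ℝ → Lp ℂ q P} (hY : Y = lpCurve fun t => hX.memLp_ofReal hq t) :
    ‖π.vectorSum f (fun v => Y t - Y (t - s * v))‖ = s ^ H * ‖π.vectorSum f Y‖ := by
  have h1 : π.vectorSum f (fun v => Y t - Y (t - s * v)) =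
      -π.vectorSum f (lpCurve (X := fun v => X (t - s * v))
        fun v => hX.memLp_ofReal hq (t - s * v)) := by
    subst hY
    simp only [TaggedPartition.vectorSum, ← Finset.sum_neg_distrib, ← smul_neg]
    refine Finset.sum_congr rfl fun i _ => ?_
    congr 1
    simp only [lpCurve]
    abel
  rw [h1, norm_neg, Lp.norm_def, eLpNorm_congr_ae (coeFn_vectorSum_lpCurve _ π f),
    hX.eLpNorm_riemannSum_reflect hs, hY, Lp.norm_def,
    eLpNorm_congr_ae (coeFn_vectorSum_lpCurve _ π f), ENNReal.toReal_mul,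
    ENNReal.toReal_ofReal (by positivity)]

end IsFractionalBrownianMotion

/-! ### Exact scaling of the moments and the small-scale limit -/

section SmallScaleLimit

variable {Ω : Type*} [MeasurableSpace Ω] {P : Measure Ω} {H : ℝ} {X : ℝ → Ω → ℝ}

/-- The integral of a Gabor filter against a fractional Brownian motion exists as an element of
`L^q`, and its norm is `s^H` times that of the integral of the modulated window over `[0, 1]`. -/
theorem IsFractionalBrownianMotion.exists_isStochIntegralLine_gaborFilter
    (hX : IsFractionalBrownianMotion P H X) (hH : 0 < H) {q : ENNReal} [Fact (1 ≤ q)]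
    (hq : q ≠ ⊤) {w : ℝ → ℂ} (hwc : Continuous w) (hws : Function.support w ⊆ Icc 0 1)
    (hwv : BoundedVariationOn w (Icc 0 1)) {s : ℝ} (hs : 0 < s) (ξ t : ℝ) {I : Lp ℂ q P}
    (hI : Tendsto (fun π : TaggedPartition 0 1 => π.vectorSum (modulate w (s * ξ))
      (lpCurve fun t => hX.memLp_ofReal hq t)) (TaggedPartition.fine 0 1) (𝓝 I)) :
    ∃ J : Lp ℂ q P, IsStochIntegralLine P X (fun u => gaborFilter w (s, ξ) (t - u)) J ∧
      ‖J‖ = s ^ H * ‖I‖ := by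
  have := TaggedPartition.fine_neBot (zero_le_one' ℝ)
  set Y := lpCurve fun t => hX.memLp_ofReal hq t with hYdef
  set h := modulate w (s * ξ) with hh
  have hY : UniformContinuous Y := hX.uniformContinuous_lpCurve hH hq
  have hhc : Continuous h := continuous_modulate hwc _
  have hhs : Function.support h ⊆ Icc 0 1 := (support_modulate_subset w _).trans hws
  have hhv : BoundedVariationOn h univ := boundedVariationOn_univ_of_support_subset
    zero_le_one hhc hhs (boundedVariationOn_modulate hwv _)
  have hfilter : (fun u => gaborFilter w (s, ξ) (t - u)) = fun u => h ((t - u) / s) :=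
    funext fun u => gaborFilter_sub_eq w hs.ne' ξ t u
  rw [hfilter]
  have hcs := hasCompactSupport_of_support_subset_Icc (support_comp_reflect_subset hhs t hs)
  obtain ⟨J, hJ, hJ'⟩ := exists_tendsto_vectorSum_line (hhc.comp (by fun_prop)) hcs
    (boundedVariationOn_comp_reflect hhv t hs) hY
  refine ⟨J, ⟨hcs, fun a b hab hsub =>
    isStochIntegral_of_tendsto_vectorSum _ (hJ' a b hab hsub)⟩, ?_⟩
  have hZ : UniformContinuous fun v => Y t - Y (t - s * v) := by
    refine uniformContinuous_const.sub (hY.comp ?_)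
    exact uniformContinuous_const.sub (uniformContinuous_id.const_mul' s)
  obtain ⟨J', hK, hK'⟩ := exists_tendsto_vectorSum_line hhc
    (hasCompactSupport_of_support_subset_Icc hhs) hhv hZ
  -- Both are limits of integrals against difference quotients, with increments `ε` and `-ε / s`
  -- that tend to zero together.
  have hJJ : J = J' := by
    simp only [Function.comp_apply, integral_smul_diffQuot_comp h Y t hs] at hJ
    have hlim := hK.comp (tendsto_neg_mul_nhdsNE_zero (inv_ne_zero hs.ne'))
    exact tendsto_nhds_unique hJ (by simpa only [div_eq_mul_inv, Function.comp_def] using hlim)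
  have h1 := (hK' 0 1 zero_le_one hhs).norm
  simp only [hX.norm_vectorSum_reflect hs t hq _ h hYdef] at h1
  rw [hJJ]
  exact tendsto_nhds_unique h1 (hI.norm.const_mul _)

theorem tendsto_averagedScatteringMoment_of_forall_eq {w : ℝ → ℂ} {γ : ℝ × ℝ} {p c : ℝ}
    (hc : ∀ t, scatteringMoment P X w γ p t = c) :
    Tendsto (averagedScatteringMoment P X w γ p) atTop (𝓝 c) := by
  refine tendsto_const_nhds.congr' ?_
  filter_upwards [eventually_gt_atTop 0] with R hR
  simp only [averagedScatteringMoment, hc, intervalIntegral.integral_const, smul_eq_mul]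
  field_simp
  ring

end SmallScaleLimit

end

theorem theorem6 {Ω : Type*} [MeasurableSpace Ω] (P : Measure Ω) [IsProbabilityMeasure P]
    (H : ℝ) (hH0 : 0 < H) (hH1 : H < 1)
    (X : ℝ → Ω → ℝ) (hX : IsFractionalBrownianMotion P H X)
    (p : ℝ) (hp : 1 ≤ p)
    (w : ℝ → ℂ) (hwc : Continuous w) (hws : Function.support w ⊆ Icc 0 1)
    (hwv : BoundedVariationOn w (Icc 0 1))
    (s ξ : ℕ → ℝ) (hs : ∀ k, 0 < s k) (hs0 : Tendsto s atTop (𝓝 0))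
    (L : ℝ) (hL : Tendsto (fun k => s k * ξ k) atTop (𝓝 L)) :
    -- the integrals `(g_γ ∗ dX)(t)` exist and have a finite `p`-th moment
    (∀ k t,
      (∃ Z, IsStochIntegralLine P X (fun u => gaborFilter w (s k, ξ k) (t - u)) Z) ∧
      Integrable (fun ω => ‖filterNoise P X w (s k, ξ k) t ω‖ ^ p) P) ∧
    -- the scattering moments do not depend on the location, and the invariant ones exist
    (∀ k,
      Tendsto (averagedScatteringMoment P X w (s k, ξ k) p) atTop
        (𝓝 (invariantScatteringMoment P X w (s k, ξ k) p)) ∧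
      ∀ t, scatteringMoment P X w (s k, ξ k) p t =
        invariantScatteringMoment P X w (s k, ξ k) p) ∧
    -- the limiting integral exists and has a finite `p`-th moment
    (∃ Z, IsStochIntegral P X (fun u => w u * Complex.exp (Complex.I * L * u)) 0 1 Z) ∧
    Integrable (fun ω =>
      ‖stochIntegral P X (fun u => w u * Complex.exp (Complex.I * L * u)) 0 1 ω‖ ^ p) P ∧
    -- the small-scale limit
    Tendsto (fun k => invariantScatteringMoment P X w (s k, ξ k) p / s k ^ (p * H)) atTop
      (𝓝 (∫ ω,
        ‖stochIntegral P X (fun u => w u * Complex.exp (Complex.I * L * u)) 0 1 ω‖ ^ p ∂P)) := by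
  have hp0 : 0 < p := by linarith
  have : Fact (1 ≤ ENNReal.ofReal p) := ⟨by simpa using hp⟩
  have hq : ENNReal.ofReal p ≠ ⊤ := ENNReal.ofReal_ne_top
  set Y := lpCurve fun t => hX.memLp_ofReal hq t with hY
  have hYc : UniformContinuous Y := hX.uniformContinuous_lpCurve hH0 hq
  have hwin : ∀ l, ∃ I : Lp ℂ (ENNReal.ofReal p) P, Tendsto
      (fun π : TaggedPartition 0 1 => π.vectorSum (modulate w l) Y)
      (TaggedPartition.fine 0 1) (𝓝 I) := fun l => by
    obtain ⟨I, -, hI⟩ := exists_tendsto_vectorSum zero_le_one (continuous_modulate hwc l)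
      (boundedVariationOn_modulate hwv l) hYc
    exact ⟨I, hI⟩
  choose I hI using hwin
  have hline : ∀ k t, ∃ J : Lp ℂ (ENNReal.ofReal p) P,
      IsStochIntegralLine P X (fun u => gaborFilter w (s k, ξ k) (t - u)) J ∧
        ‖J‖ = s k ^ H * ‖I (s k * ξ k)‖ := fun k t =>
    hX.exists_isStochIntegralLine_gaborFilter hH0 hq hwc hws hwv (hs k) (ξ k) t (hI _)
  choose J hJ hJn using hline
  have hae : ∀ k t, filterNoise P X w (s k, ξ k) t =ᵐ[P] J k t := by
    intro k t
    have hsub : Function.support (fun u => gaborFilter w (s k, ξ k) (t - u)) ⊆ Icc (t - s k) t := by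
      simp only [gaborFilter_sub_eq w (hs k).ne']
      exact support_comp_reflect_subset ((support_modulate_subset w _).trans hws) t (hs k)
    have hle : t - s k ≤ t := by linarith [hs k]
    exact ((stochIntegralLine_spec ⟨_, hJ k t⟩).2 _ _ hle hsub).ae_eq hle
      ((hJ k t).2 _ _ hle hsub)
  -- The right-hand side is free of `t`; this gives both the independence of location and the value
  -- of the average.
  have hmom : ∀ k t, scatteringMoment P X w (s k, ξ k) p t =
      (s k ^ H * ‖I (s k * ξ k)‖) ^ p := fun k t => by
    rw [scatteringMoment, integral_norm_rpow_of_ae_eq_Lp hp (hae k t), hJn]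
  have havg := fun k => tendsto_averagedScatteringMoment_of_forall_eq (hmom k)
  have hinv : ∀ k, invariantScatteringMoment P X w (s k, ξ k) p =
      (s k ^ H * ‖I (s k * ξ k)‖) ^ p := fun k => (havg k).limUnder_eq
  have hlimit : IsStochIntegral P X (fun u => w u * Complex.exp (Complex.I * L * u)) 0 1 (I L) :=
    isStochIntegral_of_tendsto_vectorSum _ (hI L)
  have hlae := (stochIntegral_spec ⟨_, hlimit⟩).ae_eq zero_le_one hlimit
  refine ⟨fun k t => ⟨⟨_, hJ k t⟩, integrable_norm_rpow_of_ae_eq_Lp hp (hae k t)⟩,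
    fun k => ⟨?_, fun t => ?_⟩, ⟨_, hlimit⟩, integrable_norm_rpow_of_ae_eq_Lp hp hlae, ?_⟩
  · rw [hinv]
    exact havg k
  · rw [hmom, hinv]
  · rw [integral_norm_rpow_of_ae_eq_Lp hp hlae]
    have hIlim : Tendsto (fun k => I (s k * ξ k)) atTop (𝓝 (I L)) :=
      tendsto_of_tendsto_vectorSum_modulate hwc hwv hYc.continuous hL (fun k => hI _) (hI L)
    refine (hIlim.norm.rpow_const (Or.inr hp0.le)).congr fun k => ?_
    have hsk : 0 < s k ^ (p * H) := Real.rpow_pos_of_pos (hs k) _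
    rw [hinv, Real.mul_rpow (Real.rpow_nonneg (hs k).le _) (norm_nonneg _),
      ← Real.rpow_mul (hs k).le, mul_comm H p, mul_div_cancel_left₀ _ hsk.ne']
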